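/- A group $H$ is residually solvable if for every $1\ne h\in H$ there is a homomorphism of $H$ onto a solvable group that does not send $h$ to $1$. Let $A$ be a residually solvable group, let $C\le A$ be any subgroup, and let $a\mapsto\bar a$ be an isomorphism of $A$ onto a group $\bar A$. Let $G=\{A*\bar A\,;\,C=\bar C\}$ be the amalgamated product in which each $c\in C$ is identified with $\bar c$. Then $G$ is an extension of a free group by a residually solvable group: there is a short exact sequence $1\to F\to G\to Q\to 1$ with $F$ free and $Q$ residually solvable. More precisely, let $\phi:G\to A$ be the folding homomorphism, given by $\phi(a)=\phi(\bar a)=a$ for $a\in A$, and let $K=\ker\phi$. Then $\phi$ is surjective, $K$ is a free group, $K$ is generated as a subgroup by the elements $a\bar a^{-1}$ with $a\in A$, and $K$ meets (the images in $G$ of) both factors trivially: $A\cap K=\{1\}=\bar A\cap K$. -/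

import Mathlib

universe u

/-- A group is residually solvable if every non-trivial element survives in some solvable
epimorphic image. (An epimorphic image is a quotient, so it is enough to let it range over
the universe of the group.) -/
def ResiduallySolvable (G : Type u) [Group G] : Prop :=
  ∀ g : G, g ≠ 1 → ∃ (S : Type u) (_ : Group S) (f : G →* S),
    Function.Surjective f ∧ Group.IsSolvable S ∧ f g ≠ 1

/-- `G` is an extension of a free group by a residually solvable group: there is a short exact
sequence `1 → F → G → Q → 1` with `F` free and `Q` residually solvable. -/
def IsFreeByResiduallySolvable (G : Type u) [Group G] : Prop :=
  ∃ (F Q : Type u) (_ : Group F) (_ : Group Q),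
    IsFreeGroup F ∧ ResiduallySolvable Q ∧ Nonempty (GroupExtension F G Q)

namespace GroupDouble

/-- The two factors `A` and `B` as a family indexed by `Bool`. -/
def Factor (A B : Type u) : Bool → Type u
  | false => A
  | true => B

instance (A B : Type u) [Group A] [Group B] : ∀ i, Group (Factor A B i)
  | false => inferInstanceAs (Group A)
  | true => inferInstanceAs (Group B)

variable {A B : Type u} [Group A] [Group B]

/-- The two embeddings of `C`: the inclusion in `A`, and `c ↦ bar c` in `B`. -/
def amalgam (C : Subgroup A) (bar : A ≃* B) : ∀ i, C →* Factor A B i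
  | false => C.subtype
  | true => bar.toMonoidHom.comp C.subtype

end GroupDouble

/-- The double `{A * B ; C = bar C}`, where `bar` is an isomorphism of `A` onto `B`: the free
product of `A` and `B` in which every `c` in `C` is identified with `bar c`. -/
abbrev GroupDouble {A B : Type u} [Group A] [Group B] (C : Subgroup A) (bar : A ≃* B) : Type u :=
  Monoid.PushoutI (GroupDouble.amalgam C bar)

namespace GroupDouble

variable {A B : Type u} [Group A] [Group B] (C : Subgroup A) (bar : A ≃* B)

/-- The canonical map of the first factor to the double. -/
def inl : A →* GroupDouble C bar :=
  Monoid.PushoutI.of (φ := amalgam C bar) false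

/-- The canonical map of the second factor to the double. -/
def inr : B →* GroupDouble C bar :=
  Monoid.PushoutI.of (φ := amalgam C bar) true

/-- The maps that define the folding map: the identity on `A`, the inverse of `bar` on `B`. -/
def foldFactor : ∀ i, Factor A B i →* A
  | false => MonoidHom.id A
  | true => bar.symm.toMonoidHom

/-- The folding map from the double to `A`, given by `a ↦ a` and `bar a ↦ a`. -/
def fold : GroupDouble C bar →* A :=
  Monoid.PushoutI.lift (foldFactor bar) C.subtype (by
    rintro (_ | _) <;> ext c
    · rfl
    · exact bar.symm_apply_apply (c : A))

theorem inl_eq_inr {c : A} (hc : c ∈ C) : inl C bar c = inr C bar (bar c) :=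
  (Monoid.PushoutI.of_apply_eq_base (amalgam C bar) false ⟨c, hc⟩).trans
    (Monoid.PushoutI.of_apply_eq_base (amalgam C bar) true ⟨c, hc⟩).symm

theorem fold_inl (a : A) : fold C bar (inl C bar a) = a :=
  Monoid.PushoutI.lift_of (φ := amalgam C bar) (i := false) _ _ _ a

theorem fold_inr (a : A) : fold C bar (inr C bar (bar a)) = a :=
  (Monoid.PushoutI.lift_of (φ := amalgam C bar) (i := true) _ _ _ (bar a)).trans
    (bar.symm_apply_apply a)

end GroupDouble

/-! Put `y_a = a (bar a)⁻¹`. It depends only on the coset `aC`, is trivial on `C`, and satisfies `b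
y_a b⁻¹ = y_{ba} y_b⁻¹`. This formula defines an action of `A` on the abstract free group `F` on the
non-trivial cosets. The double then maps to `F ⋊ A` by `a ↦ a` and `bar a ↦ x_{aC}⁻¹ a`, so that
`y_a ↦ x_{aC}`. Hence the `y_a` satisfy no relation beyond those imposed by cosets
(`toSemidirect_ofCosetFreeGroup`), and the map back shows that they generate the kernel of folding
(`ofSemidirect_toSemidirect`). The quotient by this kernel is `A` itself. -/

namespace GroupDouble

/-! ### The twisted action of `A` on the free group of cosets -/

section FreeKernel

variable {A : Type u} [Group A] (C : Subgroup A)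

/-- The free group on the non-trivial left cosets of `C`. -/
abbrev CosetFreeGroup : Type u :=
  FreeGroup {q : A ⧸ C // q ≠ ((1 : A) : A ⧸ C)}

open Classical in
/-- The generator that belongs to a coset; the trivial coset gives `1`. -/
noncomputable def cosetGen (q : A ⧸ C) : CosetFreeGroup C :=
  if h : q = ((1 : A) : A ⧸ C) then 1 else FreeGroup.of ⟨q, h⟩

theorem cosetGen_one : cosetGen C ((1 : A) : A ⧸ C) = 1 := dif_pos rfl

theorem cosetGen_val (q : {q : A ⧸ C // q ≠ ((1 : A) : A ⧸ C)}) :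
    cosetGen C q.1 = FreeGroup.of q := dif_neg q.2

theorem cosetGen_of_mem {c : A} (hc : c ∈ C) : cosetGen C (c : A ⧸ C) = 1 := by
  have h : (c : A ⧸ C) = ((1 : A) : A ⧸ C) :=
    QuotientGroup.eq.2 (by simpa using C.inv_mem hc)
  rw [h, cosetGen_one]

/-- Maps out of the free group on the non-trivial cosets agree if they agree on all `cosetGen`. -/
theorem cosetFreeGroup_hom_ext {H : Type*} [Monoid H] {f g : CosetFreeGroup C →* H}
    (h : ∀ a : A, f (cosetGen C (a : A ⧸ C)) = g (cosetGen C (a : A ⧸ C))) : f = g := by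
  ext q
  rw [← cosetGen_val]
  exact Quotient.inductionOn' q.1 h

/-- The homomorphism that extends the restriction of `f` to the non-trivial cosets. -/
noncomputable def cosetLift {H : Type*} [Group H] (f : A ⧸ C → H) : CosetFreeGroup C →* H :=
  FreeGroup.lift fun q => f q.1

theorem cosetLift_cosetGen {H : Type*} [Group H] (f : A ⧸ C → H)
    (hf : f ((1 : A) : A ⧸ C) = 1) (q : A ⧸ C) : cosetLift C f (cosetGen C q) = f q := by
  by_cases h : q = ((1 : A) : A ⧸ C)
  · rw [h, cosetGen_one, map_one, hf]
  · rw [cosetGen_val C ⟨q, h⟩]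
    exact FreeGroup.lift_apply_of

/-- The endomorphism of the free group that mirrors conjugation by `b` on the kernel of the
folding map: it sends the generator of `q` to that of `b • q` times the inverse of that of
`b C`. -/
noncomputable def cosetEnd (b : A) : CosetFreeGroup C →* CosetFreeGroup C :=
  cosetLift C fun q => cosetGen C (b • q) * (cosetGen C (b : A ⧸ C))⁻¹

theorem cosetEnd_cosetGen (b a : A) :
    cosetEnd C b (cosetGen C (a : A ⧸ C)) =
      cosetGen C ((b * a : A) : A ⧸ C) * (cosetGen C (b : A ⧸ C))⁻¹ := by
  rw [cosetEnd, cosetLift_cosetGen]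
  · rfl
  -- The defining formula is trivial at the trivial coset, so it holds for all cosets.
  · rw [MulAction.Quotient.smul_coe, smul_eq_mul, mul_one, mul_inv_cancel]

theorem cosetEnd_one : cosetEnd C 1 = MonoidHom.id _ :=
  cosetFreeGroup_hom_ext C fun a => by
    rw [cosetEnd_cosetGen, one_mul, cosetGen_one, inv_one, mul_one, MonoidHom.id_apply]

/-- Cocycle cancellation: `x_{ca} x_c⁻¹` goes to `x_{bca} x_b⁻¹ (x_{bc} x_b⁻¹)⁻¹`, where the factors
`x_b` cancel. -/
theorem cosetEnd_mul (b c : A) : cosetEnd C (b * c) = (cosetEnd C b).comp (cosetEnd C c) :=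
  cosetFreeGroup_hom_ext C fun a => by
    simp only [MonoidHom.comp_apply, cosetEnd_cosetGen, map_mul, map_inv, mul_assoc]
    group

/-- The action of `A` on the free group on the non-trivial cosets of `C`. -/
noncomputable def cosetAction : A →* MulAut (CosetFreeGroup C) where
  toFun b := MonoidHom.toMulEquiv (cosetEnd C b) (cosetEnd C b⁻¹)
    (by rw [← cosetEnd_mul, inv_mul_cancel, cosetEnd_one])
    (by rw [← cosetEnd_mul, mul_inv_cancel, cosetEnd_one])
  map_one' := MulEquiv.ext fun x => DFunLike.congr_fun (cosetEnd_one C) x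
  map_mul' b c := MulEquiv.ext fun x => DFunLike.congr_fun (cosetEnd_mul C b c) x

theorem cosetAction_apply (b : A) (x : CosetFreeGroup C) : cosetAction C b x = cosetEnd C b x :=
  rfl

/-- The embedding `a ↦ x⁻¹ a` in the semidirect product, where `x` is the generator of `a C`. -/
noncomputable def twistedInr : A →* CosetFreeGroup C ⋊[cosetAction C] A where
  toFun a := ⟨(cosetGen C (a : A ⧸ C))⁻¹, a⟩
  map_one' := by
    ext
    · exact inv_eq_one.2 (cosetGen_one C)
    · rfl
  map_mul' a b := by
    ext
    -- The twist is exactly what is needed: `x_a⁻¹ (x_{ab} x_a⁻¹)⁻¹ = x_{ab}⁻¹`.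
    · simp [cosetAction_apply, cosetEnd_cosetGen]
    · rfl

end FreeKernel

variable {A B : Type u} [Group A] [Group B] (C : Subgroup A) (bar : A ≃* B)

/-! ### Comparison of the double with the semidirect product -/

/-- The maps of the two factors to the semidirect product. -/
noncomputable def semidirectFactor :
    ∀ i, Factor A B i →* CosetFreeGroup C ⋊[cosetAction C] A
  | false => SemidirectProduct.inr
  | true => (twistedInr C).comp bar.symm.toMonoidHom

/-- The map of the double to the semidirect product. -/
noncomputable def toSemidirect : GroupDouble C bar →* CosetFreeGroup C ⋊[cosetAction C] A :=
  Monoid.PushoutI.lift (semidirectFactor C bar) (SemidirectProduct.inr.comp C.subtype) (by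
    rintro (_ | _)
    · rfl
    · refine MonoidHom.ext fun c => ?_
      change twistedInr C (bar.symm (bar (c : A))) = SemidirectProduct.inr (c : A)
      rw [bar.symm_apply_apply]
      ext
      · exact inv_eq_one.2 (cosetGen_of_mem C c.2)
      · rfl)

theorem toSemidirect_inl (a : A) :
    toSemidirect C bar (inl C bar a) = SemidirectProduct.inr a :=
  Monoid.PushoutI.lift_of (φ := amalgam C bar) (i := false) _ _ _ a

theorem toSemidirect_inr (a : A) :
    toSemidirect C bar (inr C bar (bar a)) = twistedInr C a :=
  (Monoid.PushoutI.lift_of (φ := amalgam C bar) (i := true) _ _ _ (bar a)).trans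
    (congrArg (twistedInr C) (bar.symm_apply_apply a))

theorem hom_ext {H : Type*} [Monoid H] {f g : GroupDouble C bar →* H}
    (hl : ∀ a, f (inl C bar a) = g (inl C bar a))
    (hr : ∀ a, f (inr C bar (bar a)) = g (inr C bar (bar a))) : f = g := by
  refine Monoid.PushoutI.hom_ext_nonempty ?_
  rintro (_ | _)
  · exact MonoidHom.ext hl
  · exact MonoidHom.ext fun b => by
      obtain ⟨a, rfl⟩ := bar.surjective b
      exact hr a

theorem toSemidirect_right (g : GroupDouble C bar) :
    (toSemidirect C bar g).right = fold C bar g := by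
  refine DFunLike.congr_fun (f := SemidirectProduct.rightHom.comp (toSemidirect C bar))
    (hom_ext C bar (fun a => ?_) fun a => ?_) g
  · rw [MonoidHom.comp_apply, toSemidirect_inl, fold_inl, SemidirectProduct.rightHom_inr]
  · rw [MonoidHom.comp_apply, toSemidirect_inr, fold_inr]
    rfl

/-- The element `a (bar a)⁻¹` of the double, as a function of the coset `a C`. -/
def kernelGen : A ⧸ C → GroupDouble C bar :=
  Quotient.lift (fun a : A => inl C bar a * (inr C bar (bar a))⁻¹) fun a b h => by
    have hc : a⁻¹ * b ∈ C := QuotientGroup.leftRel_apply.1 h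
    have key := inl_eq_inr C bar hc
    -- With `b = a c` and `c ∈ C`, the middle factor `c (bar c)⁻¹` is trivial in the double.
    obtain ⟨c, rfl⟩ : ∃ c, b = a * c := ⟨a⁻¹ * b, (mul_inv_cancel_left a b).symm⟩
    rw [inv_mul_cancel_left] at key
    simp only [map_mul, key, mul_inv_rev]
    group

theorem kernelGen_coe (a : A) :
    kernelGen C bar (a : A ⧸ C) = inl C bar a * (inr C bar (bar a))⁻¹ := rfl

/-- The map of the free group on the non-trivial cosets of `C` to the double. -/
noncomputable def ofCosetFreeGroup : CosetFreeGroup C →* GroupDouble C bar :=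
  cosetLift C (kernelGen C bar)

theorem ofCosetFreeGroup_cosetGen (a : A) :
    ofCosetFreeGroup C bar (cosetGen C (a : A ⧸ C)) =
      inl C bar a * (inr C bar (bar a))⁻¹ :=
  cosetLift_cosetGen C _ (by simp [kernelGen_coe]) _

/-- This retraction onto `F` makes `ofCosetFreeGroup` injective, which is where freeness of the
kernel comes from. -/
theorem toSemidirect_ofCosetFreeGroup (x : CosetFreeGroup C) :
    toSemidirect C bar (ofCosetFreeGroup C bar x) = SemidirectProduct.inl x := by
  refine DFunLike.congr_fun (f := (toSemidirect C bar).comp (ofCosetFreeGroup C bar))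
    (g := SemidirectProduct.inl)
    (cosetFreeGroup_hom_ext C fun a => ?_) x
  rw [MonoidHom.comp_apply, ofCosetFreeGroup_cosetGen, map_mul, map_inv, toSemidirect_inl,
    toSemidirect_inr, mul_inv_eq_iff_eq_mul]
  ext
  · simp [twistedInr]
  · exact (one_mul a).symm

theorem ofCosetFreeGroup_injective : Function.Injective (ofCosetFreeGroup C bar) := fun x y h =>
  SemidirectProduct.inl_injective (φ := cosetAction C) (by
    rw [← toSemidirect_ofCosetFreeGroup C bar, h, toSemidirect_ofCosetFreeGroup])

/-- The map of the semidirect product to the double. -/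
noncomputable def ofSemidirect : CosetFreeGroup C ⋊[cosetAction C] A →* GroupDouble C bar :=
  SemidirectProduct.lift (ofCosetFreeGroup C bar) (inl C bar) fun b =>
    cosetFreeGroup_hom_ext C fun a => by
      simp only [MonoidHom.comp_apply, MulEquiv.coe_toMonoidHom, cosetAction_apply,
        cosetEnd_cosetGen, map_mul, map_inv, ofCosetFreeGroup_cosetGen, MulAut.conj_apply]
      group

/-- This writes each `g` as an element of the image of `F` times `fold g`; the other composite is
not needed. -/
theorem ofSemidirect_toSemidirect (g : GroupDouble C bar) :
    ofSemidirect C bar (toSemidirect C bar g) = g := by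
  refine DFunLike.congr_fun (f := (ofSemidirect C bar).comp (toSemidirect C bar))
    (g := MonoidHom.id _) (hom_ext C bar (fun a => ?_) fun a => ?_) g
  · rw [MonoidHom.comp_apply, toSemidirect_inl]
    exact SemidirectProduct.lift_inr ..
  · rw [MonoidHom.comp_apply, toSemidirect_inr]
    change ofCosetFreeGroup C bar (cosetGen C (a : A ⧸ C))⁻¹ * inl C bar a = _
    rw [map_inv, ofCosetFreeGroup_cosetGen, MonoidHom.id_apply]
    group

/-! ### The kernel of the folding map -/

theorem ofCosetFreeGroup_range :
    (ofCosetFreeGroup C bar).range = (fold C bar).ker := by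
  ext g
  constructor
  · rintro ⟨x, rfl⟩
    rw [MonoidHom.mem_ker, ← toSemidirect_right, toSemidirect_ofCosetFreeGroup,
      SemidirectProduct.right_inl]
  · intro hg
    refine ⟨(toSemidirect C bar g).left, ?_⟩
    have h : ofCosetFreeGroup C bar (toSemidirect C bar g).left *
        inl C bar (toSemidirect C bar g).right = g := ofSemidirect_toSemidirect C bar g
    rwa [toSemidirect_right, MonoidHom.mem_ker.1 hg, map_one, mul_one] at h

theorem fold_surjective : Function.Surjective (fold C bar) := fun a =>
  ⟨inl C bar a, fold_inl C bar a⟩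

theorem isFreeGroup_ker_fold : IsFreeGroup (fold C bar).ker :=
  IsFreeGroup.ofMulEquiv
    ((MonoidHom.ofInjective (ofCosetFreeGroup_injective C bar)).trans
      (MulEquiv.subgroupCongr (ofCosetFreeGroup_range C bar)))

theorem ker_fold_eq_closure :
    (fold C bar).ker =
      Subgroup.closure (Set.range fun a : A => inl C bar a * (inr C bar (bar a))⁻¹) := by
  apply le_antisymm
  · rw [← ofCosetFreeGroup_range, MonoidHom.range_eq_map, ← FreeGroup.closure_range_of,
      MonoidHom.map_closure, Subgroup.closure_le]
    rintro _ ⟨_, ⟨⟨q, hq⟩, rfl⟩, rfl⟩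
    obtain ⟨a, rfl⟩ := QuotientGroup.mk_surjective q
    rw [← cosetGen_val C ⟨_, hq⟩, ofCosetFreeGroup_cosetGen]
    exact Subgroup.subset_closure ⟨a, rfl⟩
  · rw [Subgroup.closure_le]
    rintro _ ⟨a, rfl⟩
    rw [SetLike.mem_coe, MonoidHom.mem_ker, map_mul, map_inv, fold_inl, fold_inr, mul_inv_cancel]

theorem inl_range_inf_ker_fold : (inl C bar).range ⊓ (fold C bar).ker = ⊥ := by
  rw [eq_bot_iff]
  rintro _ ⟨⟨a, rfl⟩, h⟩
  have ha : a = 1 := (fold_inl C bar a).symm.trans h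
  rw [ha, map_one]
  exact Subgroup.one_mem _

theorem inr_range_inf_ker_fold : (inr C bar).range ⊓ (fold C bar).ker = ⊥ := by
  rw [eq_bot_iff]
  rintro _ ⟨⟨b, rfl⟩, h⟩
  obtain ⟨a, rfl⟩ := bar.surjective b
  have ha : a = 1 := (fold_inr C bar a).symm.trans h
  rw [ha, map_one, map_one]
  exact Subgroup.one_mem _

theorem isFreeByResiduallySolvable (hA : ResiduallySolvable A) :
    IsFreeByResiduallySolvable (GroupDouble C bar) :=
  ⟨(fold C bar).ker, A, inferInstance, inferInstance, isFreeGroup_ker_fold C bar, hA,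
    ⟨{ inl := (fold C bar).ker.subtype
       rightHom := fold C bar
       inl_injective := Subtype.val_injective
       range_inl_eq_ker_rightHom := Subgroup.range_subtype _
       rightHom_surjective := fold_surjective C bar }⟩⟩

end GroupDouble

theorem proposition3p1 {A B : Type u} [Group A] [Group B] (hA : ResiduallySolvable A)
    (C : Subgroup A) (bar : A ≃* B) :
    IsFreeByResiduallySolvable (GroupDouble C bar) ∧
    Function.Surjective (GroupDouble.fold C bar) ∧
    IsFreeGroup (GroupDouble.fold C bar).ker ∧
    (GroupDouble.fold C bar).ker =
      Subgroup.closure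
        (Set.range fun a : A => GroupDouble.inl C bar a * (GroupDouble.inr C bar (bar a))⁻¹) ∧
    (GroupDouble.inl C bar).range ⊓ (GroupDouble.fold C bar).ker = ⊥ ∧
    (GroupDouble.inr C bar).range ⊓ (GroupDouble.fold C bar).ker = ⊥ :=
  ⟨GroupDouble.isFreeByResiduallySolvable C bar hA, GroupDouble.fold_surjective C bar,
    GroupDouble.isFreeGroup_ker_fold C bar, GroupDouble.ker_fold_eq_closure C bar,
    GroupDouble.inl_range_inf_ker_fold C bar, GroupDouble.inr_range_inf_ker_fold C bar⟩
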